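/- Let $m\le 13$ be a nonnegative integer, let $n$ be a nonnegative integer, and let $A,B$ be positive semidefinite (hermitian) complex $n\times n$ matrices. Then the polynomial $\operatorname{tr}((A+tB)^m)$ in the indeterminate $t$ has real coefficients, and all of them are nonnegative. Equivalently, for every integer $k\ge 0$, $\operatorname{tr} S_{m,k}(A,B)$, which is the coefficient of $t^k$ in this polynomial, is real and nonnegative, where $S_{m,k}(A,B)$ denotes the sum of all words of length $m$ in $A$ and $B$ in which $B$ appears exactly $k$ times (and hence $A$ exactly $m-k$ times). -/

import Mathlib

open scoped ComplexOrder

/-- The word of length `m` in the matrices `A` and `B` encoded by `w`: the product, from left to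
right, of the letters `B` (where `w i = true`) and `A` (where `w i = false`). -/
def bmvWord {n m : ℕ} (A B : Matrix (Fin n) (Fin n) ℂ) (w : Fin m → Bool) :
    Matrix (Fin n) (Fin n) ℂ :=
  (List.ofFn fun i => if w i = true then B else A).prod

/-- `S_{m,k}(A,B)`: the sum of all words of length `m` in `A` and `B` in which `B` appears
exactly `k` times. -/
def bmvS {n : ℕ} (m k : ℕ) (A B : Matrix (Fin n) (Fin n) ℂ) : Matrix (Fin n) (Fin n) ℂ :=
  ∑ w : Fin m → Bool with (Finset.univ.filter fun i => w i = true).card = k, bmvWord A B w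

/-- The polynomial `tr((A + tB)^m)` in the indeterminate `t`, formed by taking the trace of the
`m`-th power of a matrix with polynomial entries. -/
noncomputable def bmvPoly {n : ℕ} (m : ℕ) (A B : Matrix (Fin n) (Fin n) ℂ) : Polynomial ℂ :=
  ((A.map Polynomial.C + (Polynomial.X : Polynomial ℂ) • B.map Polynomial.C) ^ m).trace

section FormalSums

/-- The strict lexicographic order on lists of natural numbers, as a Boolean function. -/
def lexLt : List ℕ → List ℕ → Bool
  | [], [] => false
  | [], _ :: _ => true
  | _ :: _, [] => false
  | a :: l, b :: l' => bif Nat.blt a b then true else bif Nat.blt b a then false else lexLt l l'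

/-- Rotation of a list by one place to the left. -/
def rotOne : List ℕ → List ℕ
  | [] => []
  | a :: l => l ++ [a]

/-- The least list among `best` and the first `n` rotations of `l`. -/
def rotMin : ℕ → List ℕ → List ℕ → List ℕ
  | 0, _, best => best
  | n + 1, l, best =>
    bif lexLt (rotOne l) best then rotMin n (rotOne l) (rotOne l) else rotMin n (rotOne l) best

/-- A representative of the orbit of a list under rotations and reversal. -/
def dihedralMin (l : List ℕ) : List ℕ :=
  rotMin l.length l.reverse (rotMin l.length l l)

/-- Binary search trees that store the coefficients of a formal sum of lists. -/
inductive SumTree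
  | leaf : SumTree
  | node (key : List ℕ) (coef : ℤ) (left right : SumTree) : SumTree

namespace SumTree

/-- Add `v` times the list `k` to a formal sum. -/
def insert (k : List ℕ) (v : ℤ) : SumTree → SumTree
  | leaf => node k v leaf leaf
  | node k' v' l r =>
    bif lexLt k k' then node k' v' (insert k v l) r
    else bif k == k' then node k' (v' + v) l r
    else node k' v' l (insert k v r)

/-- All coefficients of a formal sum vanish. -/
def allZero : SumTree → Bool
  | leaf => true
  | node _ v l r => (v == 0) && (allZero l && allZero r)

/-- The value of a formal sum at a function on lists. -/
def eval (T : List ℕ → ℝ) : SumTree → ℝ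
  | leaf => 0
  | node k v l r => v * T k + (eval T l + eval T r)

theorem eval_insert (T : List ℕ → ℝ) (k : List ℕ) (v : ℤ) (t : SumTree) :
    (t.insert k v).eval T = v * T k + t.eval T := by
  induction t with
  | leaf => simp [insert, eval]
  | node k' v' l r ihl ihr =>
    rw [insert]
    rcases h : lexLt k k' with _ | _
    · rcases h' : k == k' with _ | _
      · simp only [cond_false, eval, ihr]; ring
      · obtain rfl : k = k' := by simpa using h'
        simp only [cond_false, cond_true, eval]; push_cast; ring
    · simp only [cond_true, eval, ihl]; ring

theorem eval_eq_zero (T : List ℕ → ℝ) (t : SumTree) (h : t.allZero = true) : t.eval T = 0 := by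
  induction t with
  | leaf => rfl
  | node k v l r ihl ihr =>
    simp only [allZero, Bool.and_eq_true, beq_iff_eq] at h
    simp [eval, h.1, ihl h.2.1, ihr h.2.2]

end SumTree

/-- The value of a formal sum, given as a list of terms, at a function on lists. -/
def formalEval (T : List ℕ → ℝ) (S : List (ℤ × List ℕ)) : ℝ :=
  (S.map fun p => (p.1 : ℝ) * T p.2).sum

/-- Pass a natural number to a continuation, after evaluating it. -/
def evalNatThen {α : Type*} (n : ℕ) (K : ℕ → α) : α :=
  match n with
  | 0 => K 0
  | n + 1 => K n.succ

/-- Pass an integer to a continuation, after evaluating it. -/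
def evalIntThen {α : Type*} (z : ℤ) (K : ℤ → α) : α :=
  match z with
  | .ofNat n => evalNatThen n fun n => K (.ofNat n)
  | .negSucc n => evalNatThen n fun n => K (.negSucc n)

/-- Pass a list to a continuation, after evaluating it. -/
def evalListThen : List ℕ → (List ℕ → Bool) → Bool
  | [], K => K []
  | a :: l, K => evalNatThen a fun a => evalListThen l fun l => K (a :: l)

/-- `SumTree.insert` in continuation passing style, which keeps the tree in evaluated form during
kernel reduction. -/
def SumTree.insertThen (k : List ℕ) (v : ℤ) : SumTree → (SumTree → Bool) → Bool
  | leaf, K => evalListThen k fun k => evalIntThen v fun v => K (node k v leaf leaf)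
  | node k' v' l r, K =>
    bif lexLt k k' then insertThen k v l fun l => K (node k' v' l r)
    else bif k == k' then evalIntThen (v' + v) fun v => K (node k' v l r)
    else insertThen k v r fun r => K (node k' v' l r)

/-- A formal sum, added to the formal sum in a tree, vanishes modulo rotations and reversal of the
lists. -/
def cancels : List (ℤ × List ℕ) → SumTree → Bool
  | [], t => t.allZero
  | p :: S, t =>
    evalListThen p.2 fun l => t.insertThen (dihedralMin l) p.1 fun t => cancels S t

theorem evalNatThen_eq {α : Type*} (n : ℕ) (K : ℕ → α) : evalNatThen n K = K n := by
  cases n <;> rfl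

theorem evalIntThen_eq {α : Type*} (z : ℤ) (K : ℤ → α) : evalIntThen z K = K z := by
  cases z <;> simp [evalIntThen, evalNatThen_eq]

theorem evalListThen_eq (l : List ℕ) (K : List ℕ → Bool) : evalListThen l K = K l := by
  induction l generalizing K with
  | nil => rfl
  | cons a l ih => rw [evalListThen, evalNatThen_eq, ih]

theorem SumTree.insertThen_eq (k : List ℕ) (v : ℤ) (t : SumTree) (K : SumTree → Bool) :
    t.insertThen k v K = K (t.insert k v) := by
  induction t generalizing K with
  | leaf => simp [insertThen, insert, evalListThen_eq, evalIntThen_eq]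
  | node k' v' l r ihl ihr =>
    rw [insertThen, insert, ihl, ihr, evalIntThen_eq]
    cases lexLt k k' <;> cases k == k' <;> rfl

variable {T : List ℕ → ℝ}

theorem apply_rotMin (hrot : ∀ l, T (rotOne l) = T l) (n : ℕ) (l best : List ℕ)
    (h : T l = T best) : T (rotMin n l best) = T best := by
  induction n generalizing l best with
  | zero => rfl
  | succ n ih =>
    rw [rotMin]
    cases lexLt (rotOne l) best
    · exact ih _ _ (by rw [hrot, h])
    · exact (ih _ _ rfl).trans (by rw [hrot, h])

theorem apply_dihedralMin (hrot : ∀ l, T (rotOne l) = T l) (hrev : ∀ l, T l.reverse = T l)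
    (l : List ℕ) : T (dihedralMin l) = T l := by
  have h := apply_rotMin hrot l.length l l rfl
  rw [dihedralMin, apply_rotMin hrot _ _ _ (by rw [hrev, h]), h]

theorem formalEval_add_eval_eq_zero (hrot : ∀ l, T (rotOne l) = T l)
    (hrev : ∀ l, T l.reverse = T l) (S : List (ℤ × List ℕ)) (t : SumTree)
    (h : cancels S t = true) : formalEval T S + t.eval T = 0 := by
  induction S generalizing t with
  | nil => simp [formalEval, SumTree.eval_eq_zero T t h]
  | cons p S ih =>
    rw [cancels, evalListThen_eq, SumTree.insertThen_eq] at h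
    have := ih _ h
    rw [SumTree.eval_insert, apply_dihedralMin hrot hrev] at this
    simp only [formalEval, List.map_cons, List.sum_cons] at this ⊢
    linarith

theorem formalEval_append (S S' : List (ℤ × List ℕ)) :
    formalEval T (S ++ S') = formalEval T S + formalEval T S' := by
  simp [formalEval]

theorem formalEval_eq_zero (hrot : ∀ l, T (rotOne l) = T l) (hrev : ∀ l, T l.reverse = T l)
    (S : List (ℤ × List ℕ)) (h : cancels S .leaf = true) : formalEval T S = 0 := by
  simpa [SumTree.eval] using formalEval_add_eval_eq_zero hrot hrev S .leaf h

end FormalSums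

section Certificates

/-- Exponents `(a, l, c)` of a word `A ^ a * B * (∏ i ∈ l, A ^ i * B) * A ^ c`. -/
abbrev HalfWord := ℕ × List ℕ × ℕ

/-- The exponents of a cyclic word conjugate to `E * uᴴ * E * v`, where `E` is `1`, `A` or `B`
for `t` equal to `0`, `1` or larger. -/
def pairKey : ℕ → HalfWord → HalfWord → List ℕ
  | 0, (a, l, c), (a', l', c') => (c + c') :: (l.reverse ++ (a + a') :: l')
  | 1, (a, l, c), (a', l', c') => (c + c' + 1) :: (l.reverse ++ (a + a' + 1) :: l')
  | _, (a, l, c), (a', l', c') => c :: (l.reverse ++ a :: a' :: (l' ++ [c']))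

/-- The formal sum of `z * E * pᴴ * E * q`. -/
def crossTerms (t : ℕ) (z : ℤ) (p q : List (ℤ × HalfWord)) : List (ℤ × List ℕ) :=
  p.flatMap fun u => q.map fun v => (z * (u.1 * v.1), pairKey t u.2 v.2)

/-- A block of a sum of squares: the type of the factor `E`, a list of polynomials, and weighted
vectors of coefficients with respect to these polynomials. -/
abbrev SquareBlock := ℕ × List (List (ℤ × HalfWord)) × List (ℕ × List ℤ)

/-- The entry `(i, j)` of the Gram matrix of weighted vectors. -/
def gramEntry (i j : ℕ) : List (ℕ × List ℤ) → ℤ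
  | [] => 0
  | r :: rs => r.1 * (r.2.getD i 0 * r.2.getD j 0) + gramEntry i j rs

/-- The formal sum of the weighted squares of a block. -/
def blockTerms (b : SquareBlock) : List (ℤ × List ℕ) :=
  (List.range b.2.1.length).flatMap fun i => (List.range b.2.1.length).flatMap fun j =>
    evalIntThen (gramEntry i j b.2.2) fun z =>
      crossTerms b.1 z (b.2.1.getD i []) (b.2.1.getD j [])

/-- Prepend the letter `A` to the word `(∏ i ∈ l, A ^ i * B) * A ^ c`. -/
def bumpHead : List ℕ × ℕ → List ℕ × ℕ
  | ([], c) => ([], c + 1)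
  | (i :: l, c) => ((i + 1) :: l, c)

/-- The exponents `(l, c)` of all words `(∏ i ∈ l, A ^ i * B) * A ^ c` of length `m` with `k`
letters `B`. -/
def runs : ℕ → ℕ → List (List ℕ × ℕ)
  | 0, 0 => [([], 0)]
  | 0, _ + 1 => []
  | m + 1, 0 => (runs m 0).map bumpHead
  | m + 1, k + 1 => (runs m (k + 1)).map bumpHead ++ (runs m k).map fun p => (0 :: p.1, p.2)

/-- The exponents of the cyclic word given by `(∏ i ∈ l, A ^ i * B) * A ^ c`. -/
def closeRun : List ℕ × ℕ → List ℕ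
  | ([], c) => [c]
  | (i :: l, c) => (c + i) :: l

/-- `N` times the sum of all words of length `m` with `k` letters `B` is cyclically equivalent to
the sum of the given blocks. -/
def isCertificate (m k N : ℕ) (bs : List SquareBlock) : Bool :=
  cancels (((runs m k).map fun p => (-(N : ℤ), closeRun p)) ++ bs.flatMap blockTerms) .leaf

end Certificates

/-- Sums of squares for words with fourteen letters `A` and two letters `B`. -/
def squaresTwo : List SquareBlock := [
  (0,
    [[(1, 0, [], 7)], [(1, 1, [], 6)], [(1, 2, [], 5)], [(1, 3, [], 4)], [(1, 4, [], 3)], [(1, 5,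
    [], 2)], [(1, 6, [], 1)], [(1, 7, [], 0)]],
    [(8, [1]), (8, [0, 1]), (8, [0, 0, 1]), (8, [0, 0, 0, 1]), (8, [0, 0, 0, 0, 1]), (8, [0, 0, 0,
    0, 0, 1]), (8, [0, 0, 0, 0, 0, 0, 1]), (8, [0, 0, 0, 0, 0, 0, 0, 1])]),
  (1,
    [[(1, 0, [], 6)], [(1, 1, [], 5)], [(1, 2, [], 4)], [(1, 3, [], 3)], [(1, 4, [], 2)], [(1, 5,
    [], 1)], [(1, 6, [], 0)]],
    [(8, [1]), (8, [0, 1]), (8, [0, 0, 1]), (8, [0, 0, 0, 1]), (8, [0, 0, 0, 0, 1]), (8, [0, 0, 0,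
    0, 0, 1]), (8, [0, 0, 0, 0, 0, 0, 1])])]

/-- Sums of squares for words with ten letters `A` and four letters `B`. -/
def squaresFour : List SquareBlock := [
  (0,
    [[(1, 5, [0], 0), (1, 4, [1], 0), (1, 3, [2], 0), (1, 0, [2], 3), (1, 0, [1], 4), (1, 0, [0],
    5)], [(1, 4, [0], 1), (1, 3, [1], 1), (1, 1, [1], 3), (1, 1, [0], 4)], [(1, 3, [0], 2), (1, 2,
    [0], 3)], [(1, 2, [3], 0), (1, 0, [3], 2)], [(1, 2, [2], 1), (1, 1, [2], 2)], [(1, 2, [1],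
    2)], [(1, 1, [4], 0), (1, 0, [4], 1)], [(1, 1, [3], 1)], [(1, 0, [5], 0)]],
    [(1, [0, -3, -2, -13, -81, -39, 3, 420, -14]), (1, [2, -9, 17, 31, 13, 106, -63, 0, -28]), (1,
    [3, 18, -20, 29, 84, 0, -31, 0, -16]), (1, [5, 4, -13, 50, 0, 0, 14, 0, -10]), (1, [2, 6, -14,
    0, 0, 0, 33, 0, 1]), (1, [0, 1, 1, 0, 0, 0, 0, 0, 19]), (1, [-1, 17, 4]), (1, [2, 0, 16]), (1,
    [15]), (10, [1]), (3, [1, -1]), (3, [0, 1]), (5, [1, 0, -1]), (2, [0, 1, -1]), (160, [0, 0,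
    1]), (15, [1, 0, 0, -1]), (2, [0, 1, 0, -1]), (19, [0, 0, 1, -1]), (147, [0, 0, 0, 1]), (38,
    [1, 0, 0, 0, -1]), (42, [0, 1, 0, 0, 1]), (1, [0, 0, 1, 0, 1]), (4, [0, 0, 0, 1, -1]), (148,
    [0, 0, 0, 0, 1]), (20, [1, 0, 0, 0, 0, -1]), (21, [0, 1, 0, 0, 0, 1]), (8, [0, 0, 1, 0, 0,
    -1]), (47, [0, 0, 0, 1, 0, 1]), (25, [0, 0, 0, 0, 1, -1]), (239, [0, 0, 0, 0, 0, 1]), (13, [1,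
    0, 0, 0, 0, 0, -1]), (14, [0, 1, 0, 0, 0, 0, -1]), (3, [0, 0, 1, 0, 0, 0, -1]), (17, [0, 0, 0,
    1, 0, 0, -1]), (54, [0, 0, 0, 0, 1, 0, -1]), (21, [0, 0, 0, 0, 0, 1, -1]), (169, [0, 0, 0, 0,
    0, 0, 1]), (192, [1, 0, 0, 0, 0, 0, 0, -1]), (204, [0, 1, 0, 0, 0, 0, 0, -1]), (96, [0, 0, 1,
    0, 0, 0, 0, -1]), (60, [0, 0, 0, 1, 0, 0, 0, -1]), (60, [0, 0, 0, 0, 1, 0, 0, -1]), (36, [0,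
    0, 0, 0, 0, 1, 0, -1]), (12, [0, 0, 0, 0, 0, 0, 1, -1]), (132, [0, 0, 0, 0, 0, 0, 0, 1]), (8,
    [1, 0, 0, 0, 0, 0, 0, 0, 1]), (9, [0, 1, 0, 0, 0, 0, 0, 0, 1]), (7, [0, 0, 1, 0, 0, 0, 0, 0,
    -1]), (18, [0, 0, 0, 1, 0, 0, 0, 0, 1]), (2, [0, 0, 0, 0, 1, 0, 0, 0, -1]), (74, [0, 0, 0, 0,
    0, 1, 0, 0, -1]), (1, [0, 0, 0, 0, 0, 0, 1, 0, 1]), (120, [0, 0, 0, 0, 0, 0, 0, 1, 1]), (79,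
    [0, 0, 0, 0, 0, 0, 0, 0, 1])]),
  (0,
    [[(1, 5, [0], 0), (1, 4, [1], 0), (1, 3, [2], 0), (-1, 0, [2], 3), (-1, 0, [1], 4), (-1, 0,
    [0], 5)], [(1, 4, [0], 1), (1, 3, [1], 1), (-1, 1, [1], 3), (-1, 1, [0], 4)], [(1, 3, [0], 2),
    (-1, 2, [0], 3)], [(1, 2, [3], 0), (-1, 0, [3], 2)], [(1, 2, [2], 1), (-1, 1, [2], 2)], [(1,
    1, [4], 0), (-1, 0, [4], 1)]],
    [(1, [5, 16, 27, 37, 164, 45]), (1, [11, -10, 13, 57, 0, 106]), (1, [2, -21, 67, 18]), (1, [4,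
    -4, 0, 28]), (1, [0, 18]), (1, [17]), (184, [1]), (8, [1, -1]), (160, [0, 1]), (28, [1, 0,
    -1]), (47, [0, 1, -1]), (183, [0, 0, 1]), (12, [0, 1, 0, -1]), (30, [0, 0, 1, 1]), (191, [0,
    0, 0, 1]), (44, [1, 0, 0, 0, 1]), (32, [0, 1, 0, 0, -1]), (84, [0, 0, 1, 0, 1]), (20, [0, 0,
    0, 1, -1]), (272, [0, 0, 0, 0, 1]), (49, [1, 0, 0, 0, 0, 1]), (44, [0, 1, 0, 0, 0, -1]), (1,
    [0, 0, 1, 0, 0, -1]), (69, [0, 0, 0, 1, 0, 1]), (12, [0, 0, 0, 0, 1, 1]), (196, [0, 0, 0, 0,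
    0, 1])]),
  (1,
    [[(1, 4, [0], 0), (1, 3, [1], 0), (1, 0, [1], 3), (1, 0, [0], 4)], [(1, 3, [0], 1), (1, 1,
    [0], 3)], [(1, 2, [2], 0), (1, 0, [2], 2)], [(1, 2, [1], 1), (1, 1, [1], 2)], [(1, 2, [0],
    2)], [(1, 1, [3], 0), (1, 0, [3], 1)], [(1, 1, [2], 1)], [(1, 0, [4], 0)]],
    [(1, [-11, 33, -16, 17, -35, -49, 160, -73]), (1, [8, 3, 3, -19, -50, 64, 0, 92]), (1, [7,
    -35, 6, -13, 56, 2]), (1, [2, -8, 1, -20, 0, 55]), (1, [2, -7, 19, -3]), (1, [18, -3]), (1,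
    [0, 1, 0, 17]), (1, [0, 15]), (187, [1]), (4, [1, -1]), (157, [0, 1]), (6, [1, 0, 1]), (6, [0,
    1, 1]), (178, [0, 0, 1]), (4, [1, 0, 0, -1]), (5, [0, 1, 0, -1]), (4, [0, 0, 1, 1]), (231, [0,
    0, 0, 1]), (7, [1, 0, 0, 0, 1]), (1, [0, 1, 0, 0, 1]), (22, [0, 0, 1, 0, 1]), (11, [0, 0, 0,
    1, -1]), (170, [0, 0, 0, 0, 1]), (23, [1, 0, 0, 0, 0, -1]), (15, [0, 1, 0, 0, 0, 1]), (13, [0,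
    0, 1, 0, 0, 1]), (7, [0, 0, 0, 1, 0, 1]), (29, [0, 0, 0, 0, 1, 1]), (204, [0, 0, 0, 0, 0, 1]),
    (64, [1, 0, 0, 0, 0, 0, -1]), (96, [0, 1, 0, 0, 0, 0, 1]), (64, [0, 0, 1, 0, 0, 0, 1]), (32,
    [0, 0, 0, 1, 0, 0, -1]), (32, [0, 0, 0, 0, 1, 0, 1]), (32, [0, 0, 0, 0, 0, 1, -1]), (160, [0,
    0, 0, 0, 0, 0, 1]), (3, [1, 0, 0, 0, 0, 0, 0, -1]), (21, [0, 1, 0, 0, 0, 0, 0, 1]), (4, [0, 0,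
    1, 0, 0, 0, 0, -1]), (13, [0, 0, 0, 1, 0, 0, 0, 1]), (67, [0, 0, 0, 0, 1, 0, 0, -1]), (39, [0,
    0, 0, 0, 0, 1, 0, 1]), (32, [0, 0, 0, 0, 0, 0, 1, -1]), (236, [0, 0, 0, 0, 0, 0, 0, 1])]),
  (1,
    [[(1, 4, [0], 0), (1, 3, [1], 0), (-1, 0, [1], 3), (-1, 0, [0], 4)], [(1, 3, [0], 1), (-1, 1,
    [0], 3)], [(1, 2, [2], 0), (-1, 0, [2], 2)], [(1, 2, [1], 1), (-1, 1, [1], 2)], [(1, 1, [3],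
    0), (-1, 0, [3], 1)]],
    [(1, [4, -27, -3, -69, 97]), (1, [0, 23, 4, 44]), (1, [-4, 21, -4]), (1, [0, 0, 18]), (1,
    [16]), (268, [1]), (236, [0, 1]), (4, [1, 0, -1]), (7, [0, 1, 1]), (292, [0, 0, 1]), (12, [1,
    0, 0, -1]), (5, [0, 1, 0, 1]), (1, [0, 0, 1, 1]), (266, [0, 0, 0, 1]), (4, [1, 0, 0, 0, -1]),
    (69, [0, 1, 0, 0, -1]), (3, [0, 0, 1, 0, 1]), (27, [0, 0, 0, 1, -1]), (376, [0, 0, 0, 0, 1])]),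
  (2,
    [[(1, 5, [], 0), (1, 4, [], 1), (1, 1, [], 4), (1, 0, [], 5)], [(1, 3, [], 2), (1, 2, [], 3)]],
    [(1, [0, 19]), (1, [16]), (320, [1]), (311, [0, 1])]),
  (2,
    [[(1, 5, [], 0), (1, 4, [], 1), (-1, 1, [], 4), (-1, 0, [], 5)], [(1, 3, [], 2), (-1, 2, [],
    3)]],
    [(1, [17, 295]), (1, [21]), (253, [1]), (73, [1, 1]), (262, [0, 1])])]

/-- Sums of squares for words with eight letters `A` and six letters `B`. -/
def squaresSix : List SquareBlock := [
  (0,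
    [[(1, 3, [0, 0], 1), (1, 2, [1, 0], 1), (1, 1, [0, 1], 2), (1, 1, [0, 0], 3)], [(1, 2, [0, 2],
    0), (1, 0, [2, 0], 2)], [(1, 2, [0, 1], 1), (1, 1, [1, 0], 2)], [(1, 2, [0, 0], 2)], [(1, 4,
    [0, 0], 0), (1, 3, [1, 0], 0), (1, 3, [0, 1], 0), (1, 2, [2, 0], 0), (1, 2, [1, 1], 0), (1, 1,
    [3, 0], 0), (1, 1, [2, 1], 0), (1, 0, [1, 2], 1), (1, 0, [1, 1], 2), (1, 0, [1, 0], 3), (1, 0,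
    [0, 3], 1), (1, 0, [0, 2], 2), (1, 0, [0, 1], 3), (1, 0, [0, 0], 4)], [(1, 1, [2, 0], 1), (1,
    1, [0, 2], 1)], [(1, 1, [1, 2], 0), (1, 0, [2, 1], 1)], [(1, 1, [1, 1], 1)], [(1, 1, [0, 3],
    0), (1, 0, [3, 0], 1)], [(1, 0, [4, 0], 0), (1, 0, [3, 1], 0), (1, 0, [1, 3], 0), (1, 0, [0,
    4], 0)], [(1, 0, [2, 2], 0)]],
    [(1, [20, 65, -24, -65, 0, -205, -223, 1400, 8, 0, -165]), (1, [0, 243, -28, -13, 4, -92, 377,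
    0, -243, -9, -144]), (1, [10, 42, -21, -73, 11, -137, 0, 0, 47, 2, 343]), (1, [-3, -78, 27, 5,
    2, -20, 0, 0, 132, -4]), (1, [-22, 14, -28, 86, 3, 35, 0, 0, 0, 1]), (1, [-4, 75, -19, 0, 2,
    31, 0, 0, 0, -24]), (1, [23, 0, 64, 0, 3, -6, 0, 0, 0, -8]), (1, [8, 0, 0, 0, 1, 52, 0, 0, 0,
    1]), (1, [3, 0, 0, 0, 31, 0, 0, 0, 0, 3]), (1, [3, 0, 0, 0, 0, 0, 0, 0, 0, 19]), (1, [16]),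
    (432, [1]), (30, [1, -1]), (117, [0, 1]), (17, [1, 0, 1]), (9, [0, 1, 1]), (406, [0, 0, 1]),
    (11, [1, 0, 0, -1]), (48, [0, 1, 0, 1]), (56, [0, 0, 1, -1]), (625, [0, 0, 0, 1]), (12, [1, 0,
    0, 0, -1]), (34, [0, 1, 0, 0, 1]), (31, [0, 0, 1, 0, 1]), (23, [0, 0, 0, 1, 1]), (810, [0, 0,
    0, 0, 1]), (10, [1, 0, 0, 0, 0, 1]), (24, [0, 1, 0, 0, 0, 1]), (16, [0, 0, 1, 0, 0, 1]), (16,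
    [0, 0, 0, 1, 0, 1]), (22, [0, 0, 0, 0, 1, 1]), (641, [0, 0, 0, 0, 0, 1]), (52, [1, 0, 0, 0, 0,
    0, -1]), (152, [0, 1, 0, 0, 0, 0, 1]), (128, [0, 0, 1, 0, 0, 0, 1]), (6, [0, 0, 0, 1, 0, 0,
    -1]), (4, [0, 0, 0, 0, 1, 0, -1]), (61, [0, 0, 0, 0, 0, 1, 1]), (518, [0, 0, 0, 0, 0, 0, 1]),
    (388, [1, 0, 0, 0, 0, 0, 0, 1]), (572, [0, 1, 0, 0, 0, 0, 0, -1]), (512, [0, 0, 1, 0, 0, 0, 0,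
    1]), (368, [0, 0, 0, 1, 0, 0, 0, -1]), (188, [0, 0, 0, 0, 1, 0, 0, 1]), (264, [0, 0, 0, 0, 0,
    1, 0, -1]), (68, [0, 0, 0, 0, 0, 0, 1, -1]), (144, [0, 0, 0, 0, 0, 0, 0, 1]), (46, [1, 0, 0,
    0, 0, 0, 0, 0, -1]), (77, [0, 1, 0, 0, 0, 0, 0, 0, -1]), (23, [0, 0, 1, 0, 0, 0, 0, 0, 1]),
    (56, [0, 0, 0, 1, 0, 0, 0, 0, -1]), (3, [0, 0, 0, 0, 1, 0, 0, 0, 1]), (19, [0, 0, 0, 0, 0, 1,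
    0, 0, 1]), (229, [0, 0, 0, 0, 0, 0, 1, 0, -1]), (80, [0, 0, 0, 0, 0, 0, 0, 1, 1]), (721, [0,
    0, 0, 0, 0, 0, 0, 0, 1]), (4, [1, 0, 0, 0, 0, 0, 0, 0, 0, 1]), (5, [0, 1, 0, 0, 0, 0, 0, 0, 0,
    1]), (18, [0, 0, 1, 0, 0, 0, 0, 0, 0, -1]), (37, [0, 0, 0, 1, 0, 0, 0, 0, 0, -1]), (3, [0, 0,
    0, 0, 1, 0, 0, 0, 0, -1]), (25, [0, 0, 0, 0, 0, 1, 0, 0, 0, -1]), (9, [0, 0, 0, 0, 0, 0, 1, 0,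
    0, 1]), (61, [0, 0, 0, 0, 0, 0, 0, 0, 1, -1]), (879, [0, 0, 0, 0, 0, 0, 0, 0, 0, 1]), (130,
    [1, 0, 0, 0, 0, 0, 0, 0, 0, 0, -1]), (197, [0, 1, 0, 0, 0, 0, 0, 0, 0, 0, 1]), (37, [0, 0, 1,
    0, 0, 0, 0, 0, 0, 0, -1]), (34, [0, 0, 0, 1, 0, 0, 0, 0, 0, 0, 1]), (1, [0, 0, 0, 0, 1, 0, 0,
    0, 0, 0, -1]), (82, [0, 0, 0, 0, 0, 1, 0, 0, 0, 0, -1]), (179, [0, 0, 0, 0, 0, 0, 1, 0, 0, 0,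
    -1]), (136, [0, 0, 0, 0, 0, 0, 0, 1, 0, 0, 1]), (27, [0, 0, 0, 0, 0, 0, 0, 0, 1, 0, 1]), (102,
    [0, 0, 0, 0, 0, 0, 0, 0, 0, 1, -1]), (785, [0, 0, 0, 0, 0, 0, 0, 0, 0, 0, 1])]),
  (0,
    [[(1, 3, [0, 0], 1), (1, 2, [1, 0], 1), (-1, 1, [0, 1], 2), (-1, 1, [0, 0], 3)], [(1, 2, [0,
    2], 0), (-1, 0, [2, 0], 2)], [(1, 2, [0, 1], 1), (-1, 1, [1, 0], 2)], [(1, 4, [0, 0], 0), (1,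
    3, [1, 0], 0), (1, 3, [0, 1], 0), (1, 2, [2, 0], 0), (1, 2, [1, 1], 0), (1, 1, [3, 0], 0), (1,
    1, [2, 1], 0), (-1, 0, [1, 2], 1), (-1, 0, [1, 1], 2), (-1, 0, [1, 0], 3), (-1, 0, [0, 3], 1),
    (-1, 0, [0, 2], 2), (-1, 0, [0, 1], 3), (-1, 0, [0, 0], 4)], [(1, 1, [2, 0], 1), (-1, 1, [0,
    2], 1)], [(1, 1, [1, 2], 0), (-1, 0, [2, 1], 1)], [(1, 1, [0, 3], 0), (-1, 0, [3, 0], 1)],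
    [(1, 0, [4, 0], 0), (1, 0, [3, 1], 0), (-1, 0, [1, 3], 0), (-1, 0, [0, 4], 0)]],
    [(1, [20, 205, 75, 5, 118, 814, -229, -1]), (1, [14, 68, 28, 26, 87, 0, 254, -5]), (1, [40,
    -43, 72, -4, 238, 0, 0, 2]), (1, [-17, 128, -40, 6, 0, 0, 0, 5]), (1, [1, 0, 3, -5, 0, 0, 0,
    86]), (1, [-12, 0, 38, -5]), (1, [33, 0, 0, -8]), (1, [0, 0, 0, 31]), (642, [1]), (28, [1,
    -1]), (1030, [0, 1]), (17, [1, 0, -1]), (39, [0, 1, -1]), (590, [0, 0, 1]), (7, [1, 0, 0, 1]),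
    (27, [0, 1, 0, 1]), (6, [0, 0, 1, 1]), (782, [0, 0, 0, 1]), (62, [1, 0, 0, 0, 1]), (56, [0, 1,
    0, 0, 1]), (154, [0, 0, 1, 0, 1]), (20, [0, 0, 0, 1, -1]), (966, [0, 0, 0, 0, 1]), (300, [1,
    0, 0, 0, 0, -1]), (74, [0, 1, 0, 0, 0, 1]), (238, [0, 0, 1, 0, 0, 1]), (310, [0, 0, 0, 1, 0,
    -1]), (204, [0, 0, 0, 0, 1, 1]), (1270, [0, 0, 0, 0, 0, 1]), (104, [1, 0, 0, 0, 0, 0, -1]),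
    (31, [0, 1, 0, 0, 0, 0, -1]), (89, [0, 0, 1, 0, 0, 0, -1]), (7, [0, 0, 0, 1, 0, 0, -1]), (36,
    [0, 0, 0, 0, 1, 0, 1]), (90, [0, 0, 0, 0, 0, 1, -1]), (1039, [0, 0, 0, 0, 0, 0, 1]), (9, [1,
    0, 0, 0, 0, 0, 0, 1]), (9, [0, 1, 0, 0, 0, 0, 0, -1]), (13, [0, 0, 1, 0, 0, 0, 0, 1]), (21,
    [0, 0, 0, 1, 0, 0, 0, -1]), (77, [0, 0, 0, 0, 1, 0, 0, 1]), (62, [0, 0, 0, 0, 0, 1, 0, 1]),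
    (87, [0, 0, 0, 0, 0, 0, 1, -1]), (919, [0, 0, 0, 0, 0, 0, 0, 1])]),
  (1,
    [[(1, 2, [0, 0], 1), (1, 1, [1, 0], 1), (1, 1, [0, 1], 1), (1, 1, [0, 0], 2)], [(1, 1, [0, 2],
    0), (1, 0, [2, 0], 1)], [(1, 3, [0, 0], 0), (1, 2, [1, 0], 0), (1, 2, [0, 1], 0), (1, 1, [2,
    0], 0), (1, 1, [1, 1], 0), (1, 0, [3, 0], 0), (1, 0, [1, 1], 1), (1, 0, [1, 0], 2), (1, 0, [0,
    3], 0), (1, 0, [0, 2], 1), (1, 0, [0, 1], 2), (1, 0, [0, 0], 3)], [(1, 0, [2, 1], 0), (1, 0,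
    [1, 2], 0)]],
    [(1, [-18, -99, 11, 204]), (1, [2, 43, -10]), (1, [34, 0, -5]), (1, [0, 0, 29]), (1036, [1]),
    (12, [1, 1]), (999, [0, 1]), (12, [1, 0, 1]), (15, [0, 1, 1]), (1130, [0, 0, 1]), (88, [1, 0,
    0, -1]), (108, [0, 1, 0, -1]), (12, [0, 0, 1, 1]), (1040, [0, 0, 0, 1])]),
  (1,
    [[(1, 2, [0, 0], 1), (1, 1, [1, 0], 1), (-1, 1, [0, 1], 1), (-1, 1, [0, 0], 2)], [(1, 1, [0,
    2], 0), (-1, 0, [2, 0], 1)], [(1, 3, [0, 0], 0), (1, 2, [1, 0], 0), (1, 2, [0, 1], 0), (1, 1,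
    [2, 0], 0), (1, 1, [1, 1], 0), (1, 0, [3, 0], 0), (-1, 0, [1, 1], 1), (-1, 0, [1, 0], 2), (-1,
    0, [0, 3], 0), (-1, 0, [0, 2], 1), (-1, 0, [0, 1], 2), (-1, 0, [0, 0], 3)], [(1, 0, [2, 1],
    0), (-1, 0, [1, 2], 0)]],
    [(1, [30, 471, 12, 839]), (1, [23, 666, 3]), (1, [87, 0, -9]), (1, [0, 0, 35]), (522, [1]),
    (256, [1, 1]), (742, [0, 1]), (22, [1, 0, -1]), (246, [0, 1, 1]), (821, [0, 0, 1]), (354, [1,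
    0, 0, -1]), (7, [0, 1, 0, 1]), (84, [0, 0, 1, 1]), (2138, [0, 0, 0, 1])]),
  (2,
    [[(1, 4, [0], 0), (1, 3, [1], 0), (1, 3, [0], 1), (1, 1, [0], 3), (1, 0, [1], 3), (1, 0, [0],
    4)], [(1, 2, [2], 0), (1, 0, [2], 2)], [(1, 2, [1], 1), (1, 1, [1], 2)], [(1, 2, [0], 2)],
    [(1, 1, [3], 0), (1, 0, [3], 1)], [(1, 1, [2], 1)], [(1, 0, [4], 0)]],
    [(1, [14, -30, 67, 1063, -226, 144, -124]), (1, [-30, -46, 381, 0, -152, -153, 44]), (1, [-11,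
    -15, 0, 0, -63, 313, 11]), (1, [3, -1, 0, 0, 51, 0, -14]), (1, [0, 35, 0, 0, 0, 0, -1]), (1,
    [-5, 0, 0, 0, 0, 0, 34]), (1, [31]), (738, [1]), (6, [1, 1]), (600, [0, 1]), (36, [1, 0, -1]),
    (16, [0, 1, -1]), (694, [0, 0, 1]), (218, [1, 0, 0, -1]), (446, [0, 1, 0, -1]), (219, [0, 0,
    1, 1]), (302, [0, 0, 0, 1]), (14, [1, 0, 0, 0, 1]), (2, [0, 1, 0, 0, -1]), (110, [0, 0, 1, 0,
    1]), (26, [0, 0, 0, 1, -1]), (1010, [0, 0, 0, 0, 1]), (155, [1, 0, 0, 0, 0, -1]), (97, [0, 1,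
    0, 0, 0, 1]), (235, [0, 0, 1, 0, 0, -1]), (416, [0, 0, 0, 1, 0, -1]), (55, [0, 0, 0, 0, 1,
    1]), (471, [0, 0, 0, 0, 0, 1]), (5, [1, 0, 0, 0, 0, 0, 1]), (6, [0, 1, 0, 0, 0, 0, -1]), (192,
    [0, 0, 1, 0, 0, 0, 1]), (164, [0, 0, 0, 1, 0, 0, -1]), (1, [0, 0, 0, 0, 1, 0, -1]), (89, [0,
    0, 0, 0, 0, 1, 1]), (685, [0, 0, 0, 0, 0, 0, 1])]),
  (2,
    [[(1, 4, [0], 0), (1, 3, [1], 0), (1, 3, [0], 1), (-1, 1, [0], 3), (-1, 0, [1], 3), (-1, 0,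
    [0], 4)], [(1, 2, [2], 0), (-1, 0, [2], 2)], [(1, 2, [1], 1), (-1, 1, [1], 2)], [(1, 1, [3],
    0), (-1, 0, [3], 1)]],
    [(1, [24, 42, 251, 90]), (1, [14, 30, 0, 62]), (1, [2, 42]), (1, [33]), (1107, [1]), (8, [1,
    -1]), (1190, [0, 1]), (8, [1, 0, -1]), (14, [0, 1, -1]), (1243, [0, 0, 1]), (20, [1, 0, 0,
    -1]), (30, [0, 0, 1, -1]), (1166, [0, 0, 0, 1])])]

theorem isCertificate_squaresTwo : isCertificate 16 2 1 squaresTwo = true := by decide +kernel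

theorem isCertificate_squaresFour : isCertificate 14 4 192 squaresFour = true := by decide +kernel

theorem isCertificate_squaresSix : isCertificate 14 6 752 squaresSix = true := by decide +kernel

section WordTraces

open Polynomial Matrix

section WordCoeff

variable {R : Type*} [Ring R] (A B : R)

/-- The coefficient of `X ^ k` in `(A + X B) ^ m`. -/
noncomputable def wordCoeff (m k : ℕ) : R :=
  ((C A + C B * X) ^ m).coeff k

theorem wordCoeff_zero_zero : wordCoeff A B 0 0 = 1 := by simp [wordCoeff]

theorem wordCoeff_zero_succ (k : ℕ) : wordCoeff A B 0 (k + 1) = 0 := by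
  simp [wordCoeff, coeff_one]

theorem wordCoeff_succ_zero (m : ℕ) : wordCoeff A B (m + 1) 0 = A * wordCoeff A B m 0 := by
  simp [wordCoeff, pow_succ', add_mul, mul_assoc]

theorem wordCoeff_succ_succ (m k : ℕ) :
    wordCoeff A B (m + 1) (k + 1) = A * wordCoeff A B m (k + 1) + B * wordCoeff A B m k := by
  rw [wordCoeff, pow_succ', add_mul, coeff_add, coeff_C_mul, mul_assoc, coeff_C_mul, X_mul,
    coeff_mul_X, wordCoeff, wordCoeff]

theorem wordCoeff_succ_zero' (m : ℕ) : wordCoeff A B (m + 1) 0 = wordCoeff A B m 0 * A := by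
  simp [wordCoeff, pow_succ, mul_add, ← mul_assoc]

theorem wordCoeff_succ_succ' (m k : ℕ) :
    wordCoeff A B (m + 1) (k + 1) = wordCoeff A B m (k + 1) * A + wordCoeff A B m k * B := by
  rw [wordCoeff, pow_succ, mul_add, coeff_add, coeff_mul_C, ← mul_assoc, coeff_mul_X, coeff_mul_C,
    wordCoeff, wordCoeff]

theorem wordCoeff_eq_zero {m k : ℕ} (h : m < k) : wordCoeff A B m k = 0 := by
  induction m generalizing k with
  | zero =>
    obtain ⟨k, rfl⟩ := Nat.exists_eq_succ_of_ne_zero h.ne'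
    exact wordCoeff_zero_succ A B k
  | succ m ih =>
    obtain ⟨k, rfl⟩ := Nat.exists_eq_succ_of_ne_zero (Nat.ne_zero_of_lt h)
    rw [wordCoeff_succ_succ, ih (by omega), ih (by omega)]; simp

theorem wordCoeff_swap (a b : ℕ) : wordCoeff A B (a + b) b = wordCoeff B A (a + b) a := by
  obtain ⟨m, hm⟩ : ∃ m, m = a + b := ⟨_, rfl⟩
  rw [← hm]
  induction m generalizing a b with
  | zero => obtain rfl : a = 0 := by omega
            obtain rfl : b = 0 := by omega
            simp [wordCoeff_zero_zero]
  | succ m ih =>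
    rcases a with _ | a <;> rcases b with _ | b
    · omega
    · obtain rfl : m = b := by omega
      rw [wordCoeff_succ_succ, wordCoeff_succ_zero, wordCoeff_eq_zero A B (Nat.lt_succ_self m),
        ih 0 m (by omega)]
      simp
    · obtain rfl : m = a := by omega
      rw [wordCoeff_succ_succ, wordCoeff_succ_zero, wordCoeff_eq_zero B A (Nat.lt_succ_self m),
        ih m 0 (by omega)]
      simp
    · rw [wordCoeff_succ_succ, wordCoeff_succ_succ, ih a (b + 1) (by omega),
        ih (a + 1) b (by omega), add_comm]

end WordCoeff

variable {n : ℕ} (A B : Matrix (Fin n) (Fin n) ℂ)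

theorem isHermitian_wordCoeff {A B : Matrix (Fin n) (Fin n) ℂ} (hA : A.IsHermitian)
    (hB : B.IsHermitian) (m k : ℕ) : (wordCoeff A B m k).IsHermitian := by
  induction m generalizing k with
  | zero =>
    rcases k with _ | k
    · rw [wordCoeff_zero_zero]; exact isHermitian_one
    · rw [wordCoeff_zero_succ]; exact isHermitian_zero
  | succ m ih =>
    have h := fun k => (ih k).eq
    rcases k with _ | k
    · rw [IsHermitian, wordCoeff_succ_zero, conjTranspose_mul, h, hA.eq, ← wordCoeff_succ_zero',
        wordCoeff_succ_zero]
    · rw [IsHermitian, wordCoeff_succ_succ, conjTranspose_add, conjTranspose_mul,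
        conjTranspose_mul, h, h, hA.eq, hB.eq, ← wordCoeff_succ_succ', wordCoeff_succ_succ]

/-- The word `∏ i ∈ l, A ^ i * B`. -/
noncomputable def runWord (l : List ℕ) : Matrix (Fin n) (Fin n) ℂ :=
  (l.map fun i => A ^ i * B).prod

/-- The real part of the trace of the word `∏ i ∈ l, A ^ i * B`. -/
noncomputable def runTrace (l : List ℕ) : ℝ := (runWord A B l).trace.re

@[simp] theorem runWord_nil : runWord A B [] = 1 := rfl

theorem runWord_cons (i : ℕ) (l : List ℕ) : runWord A B (i :: l) = A ^ i * B * runWord A B l := by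
  simp [runWord]

theorem runWord_append (l l' : List ℕ) :
    runWord A B (l ++ l') = runWord A B l * runWord A B l' := by
  simp [runWord]

theorem runTrace_rotOne (l : List ℕ) : runTrace A B (rotOne l) = runTrace A B l := by
  rcases l with _ | ⟨i, l⟩
  · rfl
  · rw [rotOne, runTrace, runWord_append, trace_mul_comm, ← runWord_append]; rfl

theorem conjTranspose_runWord_mul {A B : Matrix (Fin n) (Fin n) ℂ} (hA : A.IsHermitian)
    (hB : B.IsHermitian) (l : List ℕ) :
    (runWord A B l)ᴴ * B = B * runWord A B l.reverse := by
  induction l with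
  | nil => simp
  | cons i l ih =>
    rw [runWord_cons, conjTranspose_mul, conjTranspose_mul, conjTranspose_pow, hA.eq, hB.eq,
      List.reverse_cons, runWord_append, ← mul_assoc, ih, runWord_cons, runWord_nil]
    simp only [mul_assoc, mul_one]

theorem runTrace_reverse {A B : Matrix (Fin n) (Fin n) ℂ} (hA : A.IsHermitian)
    (hB : B.IsHermitian) (l : List ℕ) : runTrace A B l.reverse = runTrace A B l := by
  rcases l with _ | ⟨i, l⟩
  · rfl
  · have h : (A ^ i * B * runWord A B l).trace =
        star (A ^ i * B * runWord A B l.reverse).trace := by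
      rw [← trace_conjTranspose, mul_assoc (A ^ i) B (runWord A B l.reverse),
        ← conjTranspose_runWord_mul hA hB, conjTranspose_mul, conjTranspose_mul,
        conjTranspose_conjTranspose, hB.eq, conjTranspose_pow, hA.eq, mul_assoc (A ^ i),
        trace_mul_comm]
    have h' : runTrace A B ((i :: l).reverse) = runTrace A B (i :: l.reverse) := by
      rw [List.reverse_cons, ← runTrace_rotOne A B (i :: l.reverse), rotOne]
    rw [h', runTrace, runTrace, runWord_cons, runWord_cons, h]
    simp

/-- The word `A ^ a * B * (∏ i ∈ l, A ^ i * B) * A ^ c`. -/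
noncomputable def halfWord (u : HalfWord) : Matrix (Fin n) (Fin n) ℂ :=
  A ^ u.1 * B * runWord A B u.2.1 * A ^ u.2.2

/-- The outer factor in a term of a sum of squares. -/
noncomputable def outerFactor : ℕ → Matrix (Fin n) (Fin n) ℂ
  | 0 => 1
  | 1 => A
  | _ => B

theorem conjTranspose_halfWord {A B : Matrix (Fin n) (Fin n) ℂ} (hA : A.IsHermitian)
    (hB : B.IsHermitian) (u : HalfWord) :
    (halfWord A B u)ᴴ = A ^ u.2.2 * B * runWord A B u.2.1.reverse * A ^ u.1 := by
  rw [halfWord]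
  simp only [conjTranspose_mul, conjTranspose_pow, hA.eq, hB.eq]
  rw [← mul_assoc _ B, conjTranspose_runWord_mul hA hB]
  simp only [mul_assoc]

theorem runTrace_pairKey {A B : Matrix (Fin n) (Fin n) ℂ} (hA : A.IsHermitian)
    (hB : B.IsHermitian) (t : ℕ) (u v : HalfWord) :
    runTrace A B (pairKey t u v) =
      (outerFactor A B t * (halfWord A B u)ᴴ * outerFactor A B t * halfWord A B v).trace.re := by
  obtain ⟨a, l, c⟩ := u
  obtain ⟨a', l', c'⟩ := v
  rw [conjTranspose_halfWord hA hB]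
  rcases t with _ | _ | t
  · rw [pairKey, runTrace, runWord_cons, runWord_append, runWord_cons]
    simp only [outerFactor, halfWord, one_mul, mul_one]
    rw [← mul_assoc (_ * _) _ (A ^ c'), trace_mul_comm _ (A ^ c'), add_comm c c', pow_add, pow_add]
    simp only [mul_assoc]
  · rw [pairKey, runTrace, runWord_cons, runWord_append, runWord_cons]
    simp only [outerFactor, halfWord]
    rw [← mul_assoc (_ * _) _ (A ^ c'), trace_mul_comm _ (A ^ c'),
      show c + c' + 1 = c' + (1 + c) by omega, show a + a' + 1 = a + (1 + a') by omega]
    simp only [pow_add, pow_one, mul_assoc]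
  · rw [pairKey, runTrace, runWord_cons, runWord_append, runWord_cons, runWord_cons,
      runWord_append, runWord_cons, runWord_nil]
    · simp only [outerFactor, halfWord, mul_one]
      rw [mul_assoc B, mul_assoc B, trace_mul_comm B]
      simp only [mul_assoc]
    all_goals simp

/-- The matrix given by a linear combination of words. -/
noncomputable def polyMatrix (p : List (ℤ × HalfWord)) : Matrix (Fin n) (Fin n) ℂ :=
  (p.map fun u => (u.1 : ℂ) • halfWord A B u.2).sum

/-- The real part of `tr (E * Pᴴ * E * Q)`. -/
noncomputable def traceForm (E P Q : Matrix (Fin n) (Fin n) ℂ) : ℝ := (E * Pᴴ * E * Q).trace.re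

theorem traceForm_add_left (E P P' Q : Matrix (Fin n) (Fin n) ℂ) :
    traceForm E (P + P') Q = traceForm E P Q + traceForm E P' Q := by
  simp [traceForm, mul_add, add_mul]

theorem traceForm_add_right (E P Q Q' : Matrix (Fin n) (Fin n) ℂ) :
    traceForm E P (Q + Q') = traceForm E P Q + traceForm E P Q' := by
  simp [traceForm, mul_add]

theorem traceForm_smul_left (E P Q : Matrix (Fin n) (Fin n) ℂ) (z : ℤ) :
    traceForm E ((z : ℂ) • P) Q = z * traceForm E P Q := by
  simp [traceForm, conjTranspose_smul]

theorem traceForm_smul_right (E P Q : Matrix (Fin n) (Fin n) ℂ) (z : ℤ) :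
    traceForm E P ((z : ℂ) • Q) = z * traceForm E P Q := by
  simp [traceForm]

theorem traceForm_zero_left (E Q : Matrix (Fin n) (Fin n) ℂ) : traceForm E 0 Q = 0 := by
  simp [traceForm]

theorem traceForm_zero_right (E P : Matrix (Fin n) (Fin n) ℂ) : traceForm E P 0 = 0 := by
  simp [traceForm]

theorem traceForm_sum_sum {ι : Type*} (E : Matrix (Fin n) (Fin n) ℂ) (s : Finset ι) (z : ι → ℤ)
    (P : ι → Matrix (Fin n) (Fin n) ℂ) :
    traceForm E (∑ i ∈ s, (z i : ℂ) • P i) (∑ i ∈ s, (z i : ℂ) • P i) =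
      ∑ i ∈ s, ∑ j ∈ s, (z i * z j : ℝ) * traceForm E (P i) (P j) := by
  have hr : ∀ Q, traceForm E Q (∑ i ∈ s, (z i : ℂ) • P i) = ∑ i ∈ s, z i * traceForm E Q (P i) := by
    intro Q
    induction s using Finset.cons_induction with
    | empty => simp [traceForm_zero_right]
    | cons i s hi ih =>
      rw [Finset.sum_cons, Finset.sum_cons, traceForm_add_right, traceForm_smul_right, ih]
  have hl : ∀ Q, traceForm E (∑ i ∈ s, (z i : ℂ) • P i) Q = ∑ i ∈ s, z i * traceForm E (P i) Q := by
    clear hr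
    intro Q
    induction s using Finset.cons_induction with
    | empty => simp [traceForm_zero_left]
    | cons i s hi ih =>
      rw [Finset.sum_cons, Finset.sum_cons, traceForm_add_left, traceForm_smul_left, ih]
  rw [hl]
  refine Finset.sum_congr rfl fun i _ => ?_
  rw [hr, Finset.mul_sum]
  exact Finset.sum_congr rfl fun j _ => by ring

theorem exists_conjTranspose_mul_self_of_posSemidef {E : Matrix (Fin n) (Fin n) ℂ}
    (hE : E.PosSemidef) : ∃ K : Matrix (Fin n) (Fin n) ℂ, E = Kᴴ * K := by
  open scoped MatrixOrder Matrix.Norms.L2Operator in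
  exact CStarAlgebra.nonneg_iff_eq_star_mul_self.mp hE.nonneg

theorem trace_mul_re_nonneg {P Q : Matrix (Fin n) (Fin n) ℂ} (hP : P.PosSemidef)
    (hQ : Q.PosSemidef) : 0 ≤ (P * Q).trace.re := by
  obtain ⟨K, rfl⟩ := exists_conjTranspose_mul_self_of_posSemidef hP
  rw [mul_assoc, trace_mul_comm]
  exact (Complex.le_def.mp (hQ.mul_mul_conjTranspose_same K).trace_nonneg).1

theorem traceForm_self_nonneg {E : Matrix (Fin n) (Fin n) ℂ} (hE : E.PosSemidef)
    (P : Matrix (Fin n) (Fin n) ℂ) : 0 ≤ traceForm E P P := by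
  rw [traceForm, mul_assoc, mul_assoc, ← mul_assoc Pᴴ]
  exact trace_mul_re_nonneg hE (hE.conjTranspose_mul_mul_same P)

theorem formalEval_crossTerms {A B : Matrix (Fin n) (Fin n) ℂ} (hA : A.IsHermitian)
    (hB : B.IsHermitian) (t : ℕ) (z : ℤ) (p q : List (ℤ × HalfWord)) :
    formalEval (runTrace A B) (crossTerms t z p q) =
      z * traceForm (outerFactor A B t) (polyMatrix A B p) (polyMatrix A B q) := by
  induction p with
  | nil => simp [crossTerms, formalEval, polyMatrix, traceForm_zero_left]
  | cons u p ih =>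
    have h : ∀ q : List (ℤ × HalfWord), formalEval (runTrace A B)
        (q.map fun v => (z * (u.1 * v.1), pairKey t u.2 v.2)) =
        z * (u.1 * traceForm (outerFactor A B t) (halfWord A B u.2) (polyMatrix A B q)) := by
      intro q
      induction q with
      | nil => simp [formalEval, polyMatrix, traceForm_zero_right]
      | cons v q ih =>
        simp only [formalEval, polyMatrix, List.map_cons, List.sum_cons] at ih ⊢
        rw [traceForm_add_right, traceForm_smul_right, ih, runTrace_pairKey hA hB, ← traceForm]
        push_cast; ring
    rw [crossTerms, List.flatMap_cons, formalEval_append, h, ← crossTerms, ih,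
      polyMatrix.eq_1 A B (u :: p), List.map_cons, List.sum_cons, traceForm_add_left, traceForm_smul_left,
      ← polyMatrix]
    ring

theorem formalEval_flatMap_range (T : List ℕ → ℝ) (k : ℕ) (f : ℕ → List (ℤ × List ℕ)) :
    formalEval T ((List.range k).flatMap f) = ∑ i ∈ Finset.range k, formalEval T (f i) := by
  induction k with
  | zero => simp [formalEval]
  | succ k ih => rw [List.range_succ, List.flatMap_append, formalEval_append, ih,
      Finset.sum_range_succ]; simp

theorem sum_gramEntry_mul_traceForm_nonneg {E : Matrix (Fin n) (Fin n) ℂ} (hE : E.PosSemidef)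
    (s : Finset ℕ) (P : ℕ → Matrix (Fin n) (Fin n) ℂ) (rs : List (ℕ × List ℤ)) :
    0 ≤ ∑ i ∈ s, ∑ j ∈ s, (gramEntry i j rs : ℝ) * traceForm E (P i) (P j) := by
  induction rs with
  | nil => simp [gramEntry]
  | cons r rs ih =>
    have h := mul_nonneg r.1.cast_nonneg
      (traceForm_self_nonneg hE (∑ i ∈ s, ((r.2.getD i 0 : ℤ) : ℂ) • P i))
    rw [traceForm_sum_sum, Finset.mul_sum] at h
    refine (add_nonneg h ih).trans_eq ?_
    rw [← Finset.sum_add_distrib]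
    refine Finset.sum_congr rfl fun i _ => ?_
    rw [Finset.mul_sum, ← Finset.sum_add_distrib]
    refine Finset.sum_congr rfl fun j _ => ?_
    rw [gramEntry]
    push_cast
    ring

theorem formalEval_blockTerms_nonneg {A B : Matrix (Fin n) (Fin n) ℂ} (hA : A.PosSemidef)
    (hB : B.PosSemidef) (b : SquareBlock) : 0 ≤ formalEval (runTrace A B) (blockTerms b) := by
  have hE : (outerFactor A B b.1).PosSemidef := by
    rcases b.1 with _ | _ | _
    exacts [PosSemidef.one, hA, hB]
  simp only [blockTerms, evalIntThen_eq, formalEval_flatMap_range,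
    formalEval_crossTerms hA.isHermitian hB.isHermitian]
  exact sum_gramEntry_mul_traceForm_nonneg hE _ _ _

theorem runWord_bumpHead (p : List ℕ × ℕ) :
    runWord A B (bumpHead p).1 * A ^ (bumpHead p).2 = A * (runWord A B p.1 * A ^ p.2) := by
  obtain ⟨_ | ⟨i, l⟩, c⟩ := p
  · simp [bumpHead, pow_succ']
  · simp [bumpHead, runWord_cons, pow_succ', mul_assoc]

theorem wordCoeff_eq_sum_runs (m k : ℕ) :
    wordCoeff A B m k = ((runs m k).map fun p => runWord A B p.1 * A ^ p.2).sum := by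
  induction m generalizing k with
  | zero =>
    rcases k with _ | k
    · simp [runs, wordCoeff_zero_zero]
    · simp [runs, wordCoeff_zero_succ]
  | succ m ih =>
    rcases k with _ | k
    · rw [wordCoeff_succ_zero, runs, ih]
      simp [Function.comp_def, runWord_bumpHead, List.sum_map_mul_left]
    · rw [wordCoeff_succ_succ, runs, ih, ih]
      simp [Function.comp_def, runWord_bumpHead, runWord_cons, List.sum_map_mul_left, mul_assoc]

theorem length_of_mem_runs {m k : ℕ} {p : List ℕ × ℕ} (hp : p ∈ runs m k) : p.1.length = k := by
  induction m generalizing k p with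
  | zero => rcases k with _ | k <;> simp_all [runs]
  | succ m ih =>
    have hb : ∀ q : List ℕ × ℕ, (bumpHead q).1.length = q.1.length := by
      rintro ⟨_ | _, _⟩ <;> rfl
    rcases k with _ | k
    · simp only [runs, List.mem_map] at hp
      obtain ⟨q, hq, rfl⟩ := hp
      rw [hb, ih hq]
    · simp only [runs, List.mem_append, List.mem_map] at hp
      obtain ⟨q, hq, rfl⟩ | ⟨q, hq, rfl⟩ := hp
      · rw [hb, ih hq]
      · simp [ih hq]

theorem runTrace_closeRun (p : List ℕ × ℕ) (hp : p.1 ≠ []) :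
    runTrace A B (closeRun p) = (runWord A B p.1 * A ^ p.2).trace.re := by
  obtain ⟨_ | ⟨i, l⟩, c⟩ := p
  · exact absurd rfl hp
  · rw [closeRun, runTrace, runWord_cons, runWord_cons, trace_mul_comm _ (A ^ _), pow_add]
    simp only [mul_assoc]

theorem formalEval_closeRun (N : ℤ) (L : List (List ℕ × ℕ)) (hL : ∀ p ∈ L, p.1 ≠ []) :
    formalEval (runTrace A B) (L.map fun p => (N, closeRun p)) =
      N * (L.map fun p => runWord A B p.1 * A ^ p.2).sum.trace.re := by
  induction L with
  | nil => simp [formalEval]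
  | cons p L ih =>
    have h := ih fun q hq => hL q (List.mem_cons_of_mem _ hq)
    simp only [formalEval, List.map_cons, List.sum_cons, trace_add, Complex.add_re] at h ⊢
    rw [h, runTrace_closeRun A B p (hL p List.mem_cons_self)]
    ring

theorem trace_wordCoeff_nonneg_of_isCertificate {m k N : ℕ} (hN : 0 < N) (hk : 0 < k)
    {bs : List SquareBlock} (h : isCertificate m k N bs = true) {A B : Matrix (Fin n) (Fin n) ℂ}
    (hA : A.PosSemidef) (hB : B.PosSemidef) : 0 ≤ (wordCoeff A B m k).trace.re := by
  have h0 := formalEval_eq_zero (runTrace_rotOne A B)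
    (runTrace_reverse hA.isHermitian hB.isHermitian) _ h
  rw [formalEval_append, formalEval_closeRun, ← wordCoeff_eq_sum_runs] at h0
  · have hs : 0 ≤ formalEval (runTrace A B) (bs.flatMap blockTerms) := by
      clear h h0
      induction bs with
      | nil => simp [formalEval]
      | cons b bs ih =>
        rw [List.flatMap_cons, formalEval_append]
        exact add_nonneg (formalEval_blockTerms_nonneg hA hB b) ih
    have hN' : (0 : ℝ) < N := by exact_mod_cast hN
    push_cast at h0
    by_contra! hlt
    nlinarith
  · intro p hp h1
    have := length_of_mem_runs hp
    rw [h1] at this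
    simp at this
    omega

end WordTraces

section TraceDescent

open Polynomial Matrix

section PowDeriv

variable {R : Type*} [Ring R]

/-- The derivative of the `m`-th power of `M` in the direction `M'`. -/
def powDeriv (M M' : R) : ℕ → R
  | 0 => 0
  | m + 1 => powDeriv M M' m * M + M ^ m * M'

theorem derivative_pow_eq_powDeriv (M : R[X]) (m : ℕ) :
    derivative (M ^ m) = powDeriv M (derivative M) m := by
  induction m with
  | zero => simp [powDeriv]
  | succ m ih => rw [pow_succ, derivative_mul, ih, powDeriv]

end PowDeriv

variable {n : ℕ}

theorem trace_coeff_mul_comm (P Q : (Matrix (Fin n) (Fin n) ℂ)[X]) (k : ℕ) :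
    ((P * Q).coeff k).trace = ((Q * P).coeff k).trace := by
  rw [coeff_mul, coeff_mul, trace_sum, trace_sum, ← Finset.Nat.sum_antidiagonal_swap]
  exact Finset.sum_congr rfl fun p _ => trace_mul_comm _ _

theorem trace_coeff_powDeriv_mul_pow (M M' : (Matrix (Fin n) (Fin n) ℂ)[X]) (m j k : ℕ) :
    ((powDeriv M M' (m + 1) * M ^ j).coeff k).trace =
      (m + 1) * ((M' * M ^ (m + j)).coeff k).trace := by
  induction m generalizing j with
  | zero => simp [powDeriv]
  | succ m ih =>
    rw [powDeriv, add_mul, coeff_add, trace_add, mul_assoc, ← pow_succ', ih, mul_assoc,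
      trace_coeff_mul_comm (M ^ (m + 1)), mul_assoc, ← pow_add,
      show m + (j + 1) = m + 1 + j by omega, add_comm j]
    push_cast; ring

variable (A B : Matrix (Fin n) (Fin n) ℂ)

theorem trace_wordCoeff_succ_succ (m k : ℕ) :
    (k + 1) * (wordCoeff A B (m + 1) (k + 1)).trace =
      (m + 1) * (B * wordCoeff A B m k).trace := by
  have h := trace_coeff_powDeriv_mul_pow (C A + C B * X) (C B) m 0 k
  have h' := derivative_pow_eq_powDeriv (C A + C B * X) (m + 1)
  rw [show derivative (C A + C B * X) = C B by simp] at h'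
  rw [pow_zero, mul_one, ← h', coeff_derivative, add_zero, coeff_C_mul] at h
  rw [wordCoeff, wordCoeff, ← h, ← Nat.cast_succ, ← nsmul_eq_mul, ← trace_smul, nsmul_eq_mul,
    Nat.cast_comm, Nat.cast_succ]

theorem wordCoeff_smul (s : ℂ) (m k : ℕ) :
    wordCoeff (s • A) (s • B) m k = s ^ m • wordCoeff A B m k := by
  induction m generalizing k with
  | zero => rcases k with _ | k <;> simp [wordCoeff_zero_zero, wordCoeff_zero_succ]
  | succ m ih =>
    rcases k with _ | k
    · rw [wordCoeff_succ_zero, wordCoeff_succ_zero, ih, smul_mul_smul_comm, pow_succ']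
    · rw [wordCoeff_succ_succ, wordCoeff_succ_succ, ih, ih, smul_mul_smul_comm,
        smul_mul_smul_comm, pow_succ', smul_add]

theorem wordCoeff_zero_right_succ (m k : ℕ) : wordCoeff A 0 m (k + 1) = 0 := by
  induction m with
  | zero => exact wordCoeff_zero_succ A 0 k
  | succ m ih => rw [wordCoeff_succ_succ, ih]; simp

theorem wordCoeff_zero_eq_pow (m : ℕ) : wordCoeff A B m 0 = A ^ m := by
  induction m with
  | zero => simp [wordCoeff_zero_zero]
  | succ m ih => rw [wordCoeff_succ_zero, ih, pow_succ']

theorem continuous_wordCoeff {Y : Type*} [TopologicalSpace Y]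
    {f g : Y → Matrix (Fin n) (Fin n) ℂ} (hf : Continuous f) (hg : Continuous g) (m k : ℕ) :
    Continuous fun y => wordCoeff (f y) (g y) m k := by
  induction m generalizing k with
  | zero =>
    rcases k with _ | k
    · simp only [wordCoeff_zero_zero]; exact continuous_const
    · simp only [wordCoeff_zero_succ]; exact continuous_const
  | succ m ih =>
    rcases k with _ | k
    · simp only [wordCoeff_succ_zero]; exact hf.mul (ih 0)
    · simp only [wordCoeff_succ_succ]; exact (hf.mul (ih _)).add (hg.mul (ih k))

section Deriv

variable {R : Type*} [NormedRing R] [NormedAlgebra ℝ R]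

theorem hasDerivAt_wordCoeff {f g : ℝ → R} {f' g' : R} {x : ℝ} (hf : HasDerivAt f f' x)
    (hg : HasDerivAt g g' x) (m k : ℕ) :
    HasDerivAt (fun y => wordCoeff (f y) (g y) m k)
      ((powDeriv (C (f x) + C (g x) * X) (C f' + C g' * X) m).coeff k) x := by
  induction m generalizing k with
  | zero =>
    rcases k with _ | k
    · simp only [wordCoeff_zero_zero, powDeriv, coeff_zero]; exact hasDerivAt_const _ _
    · simp only [wordCoeff_zero_succ, powDeriv, coeff_zero]; exact hasDerivAt_const _ _
  | succ m ih =>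
    rcases k with _ | k
    · simp only [wordCoeff_succ_zero']
      refine ((ih 0).fun_mul hf).congr_deriv ?_
      simp [powDeriv, mul_add, ← mul_assoc, wordCoeff]
    · simp only [wordCoeff_succ_succ']
      refine (((ih (k + 1)).fun_mul hf).fun_add ((ih k).fun_mul hg)).congr_deriv ?_
      simp only [powDeriv, mul_add, ← mul_assoc, wordCoeff, coeff_add, coeff_mul_C, coeff_mul_X]
      abel

theorem hasDerivAt_one_add_smul_mul_mul (H P : R) :
    HasDerivAt (fun y : ℝ => (1 + y • H) * P * (1 + y • H)) (H * P + P * H) 0 := by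
  have h : HasDerivAt (fun y : ℝ => 1 + y • H) H 0 := by
    simpa using ((hasDerivAt_id' (0 : ℝ)).smul_const H).const_add 1
  simpa using (h.mul_const P).fun_mul h

theorem hasDerivAt_apply_one_add_smul_mul_mul (L : R →L[ℝ] ℝ) (H P : R) :
    HasDerivAt (fun y : ℝ => L ((1 + y • H) * P * (1 + y • H))) (L (H * P + P * H)) 0 :=
  L.hasFDerivAt.comp_hasDerivAt 0 (hasDerivAt_one_add_smul_mul_mul H P)

theorem hasDerivAt_apply_wordCoeff (L : R →L[ℝ] ℝ) (A B H : R) (m k : ℕ) :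
    HasDerivAt
      (fun y : ℝ => L (wordCoeff ((1 + y • H) * A * (1 + y • H))
        ((1 + y • H) * B * (1 + y • H)) m k))
      (L ((powDeriv (C A + C B * X) (C (H * A + A * H) + C (H * B + B * H) * X) m).coeff k)) 0 := by
  have h := L.hasFDerivAt.comp_hasDerivAt 0 (hasDerivAt_wordCoeff
    (hasDerivAt_one_add_smul_mul_mul H A) (hasDerivAt_one_add_smul_mul_mul H B) m k)
  simpa [Function.comp_def] using h

end Deriv

section MatrixDeriv

open scoped Matrix.Norms.Operator

/-- The real part of the trace, as a continuous real linear form. -/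
noncomputable def traceReCLM (n : ℕ) : Matrix (Fin n) (Fin n) ℂ →L[ℝ] ℝ where
  toLinearMap := Complex.reLm ∘ₗ traceLinearMap (Fin n) ℝ ℂ
  cont := Complex.continuous_re.comp continuous_id.matrix_trace

theorem hasDerivAt_trace_one_add_smul_mul_mul (H P : Matrix (Fin n) (Fin n) ℂ) :
    HasDerivAt (fun y : ℝ => ((1 + y • H) * P * (1 + y • H)).trace.re) (H * P + P * H).trace.re 0 :=
  hasDerivAt_apply_one_add_smul_mul_mul (traceReCLM n) H P

theorem hasDerivAt_trace_wordCoeff (A B H : Matrix (Fin n) (Fin n) ℂ) (m k : ℕ) :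
    HasDerivAt
      (fun y : ℝ => (wordCoeff ((1 + y • H) * A * (1 + y • H))
        ((1 + y • H) * B * (1 + y • H)) m k).trace.re)
      ((powDeriv (C A + C B * X) (C (H * A + A * H) + C (H * B + B * H) * X)
        m).coeff k).trace.re 0 :=
  hasDerivAt_apply_wordCoeff (traceReCLM n) A B H m k

end MatrixDeriv

/-- A minimiser of the trace of a word sum, relative to the trace of `A + B`, satisfies a
first order condition. -/
theorem trace_mul_wordCoeff_of_min {m k : ℕ} {A B H : Matrix (Fin n) (Fin n) ℂ}
    (hA : A.PosSemidef) (hB : B.PosSemidef) (hH : H.IsHermitian) (htr : (A + B).trace.re = 1)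
    (hmin : ∀ A' B' : Matrix (Fin n) (Fin n) ℂ, A'.PosSemidef → B'.PosSemidef →
      (wordCoeff A B (m + 1) k).trace.re * (A' + B').trace.re ^ (m + 1) ≤
        (wordCoeff A' B' (m + 1) k).trace.re) :
    (H * wordCoeff A B (m + 1) k).trace.re =
      (wordCoeff A B (m + 1) k).trace.re * (H * (A + B)).trace.re := by
  set F := (wordCoeff A B (m + 1) k).trace.re
  have hE : ∀ y : ℝ, (1 + y • H)ᴴ = 1 + y • H := fun y => by
    rw [conjTranspose_add, conjTranspose_smul, hH.eq]; simp
  have hps : ∀ (y : ℝ) (P : Matrix (Fin n) (Fin n) ℂ), P.PosSemidef →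
      ((1 + y • H) * P * (1 + y • H)).PosSemidef := fun y P hP => by
    have h := hP.mul_mul_conjTranspose_same (1 + y • H)
    rwa [hE] at h
  have hd := (hasDerivAt_trace_wordCoeff A B H (m + 1) k).fun_sub
    ((((hasDerivAt_trace_one_add_smul_mul_mul H A).fun_add
      (hasDerivAt_trace_one_add_smul_mul_mul H B)).fun_pow (m + 1)).const_mul F)
  have htr' : A.trace.re + B.trace.re = 1 := by rw [← htr, trace_add, Complex.add_re]
  have hzero := IsLocalMin.hasDerivAt_eq_zero (Filter.Eventually.of_forall fun y => ?_) hd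
  · simp only [zero_smul, add_zero, one_mul, mul_one, htr', one_pow] at hzero
    have hM : (C (H * A + A * H) + C (H * B + B * H) * X : (Matrix (Fin n) (Fin n) ℂ)[X]) =
        C H * (C A + C B * X) + (C A + C B * X) * C H := by
      simp only [map_add, C_mul, mul_add, add_mul, mul_assoc, X_mul_C]
      abel
    have h1 := trace_coeff_powDeriv_mul_pow (C A + C B * X)
      (C (H * A + A * H) + C (H * B + B * H) * X) m 0 k
    have h4 : ∀ M N : (Matrix (Fin n) (Fin n) ℂ)[X], (((N * M + M * N) * M ^ m).coeff k).trace =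
        ((N * M ^ (m + 1)).coeff k).trace + ((N * M ^ (m + 1)).coeff k).trace := fun M N => by
      rw [add_mul, coeff_add, trace_add, mul_assoc M N, trace_coeff_mul_comm M, mul_assoc,
        mul_assoc, ← pow_succ', ← pow_succ]
    rw [pow_zero, mul_one, add_zero, hM, h4, coeff_C_mul, ← hM] at h1
    change _ = _ * ((H * wordCoeff A B (m + 1) k).trace + (H * wordCoeff A B (m + 1) k).trace) at h1
    rw [h1] at hzero
    have h2 : (H * A + A * H).trace.re + (H * B + B * H).trace.re = 2 * (H * (A + B)).trace.re := by
      simp only [mul_add, trace_add, trace_mul_comm A H, trace_mul_comm B H, Complex.add_re]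
      ring
    rw [h2] at hzero
    have h3 : ∀ z : ℂ, (((m : ℂ) + 1) * (z + z)).re = (m + 1) * (2 * z.re) := fun z => by
      have : (m : ℂ) + 1 = ((m + 1 : ℝ) : ℂ) := by push_cast; rfl
      rw [this, Complex.re_ofReal_mul, Complex.add_re, two_mul]
    rw [h3] at hzero
    have hm : (0 : ℝ) < m + 1 := by positivity
    push_cast at hzero
    have : ((m : ℝ) + 1) * ((H * wordCoeff A B (m + 1) k).trace.re
        - F * (H * (A + B)).trace.re) = 0 := by linarith
    rcases mul_eq_zero.mp this with h | h <;> linarith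
  · have := hmin _ _ (hps y A hA) (hps y B hB)
    rw [trace_add, Complex.add_re] at this
    simp only [zero_smul, add_zero, one_mul, mul_one, htr', one_pow]
    change F - F ≤ _
    linarith

theorem trace_conjTranspose_mul_self_re (P : Matrix (Fin n) (Fin n) ℂ) :
    (Pᴴ * P).trace.re = ∑ j, ∑ i, ‖P i j‖ ^ 2 := by
  simp only [trace, diag_apply, mul_apply, conjTranspose_apply, Complex.re_sum]
  refine Finset.sum_congr rfl fun j _ => Finset.sum_congr rfl fun i _ => ?_
  rw [Complex.star_def, ← Complex.normSq_eq_conj_mul_self, Complex.ofReal_re,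
    Complex.normSq_eq_norm_sq]

theorem isCompact_trace_eq_one :
    IsCompact {p : Matrix (Fin n) (Fin n) ℂ × Matrix (Fin n) (Fin n) ℂ |
      (p.1ᴴ * p.1 + p.2ᴴ * p.2).trace.re = 1} := by
  have hS : IsCompact
      {P : Matrix (Fin n) (Fin n) ℂ | ∀ i j, P i j ∈ Metric.closedBall (0 : ℂ) 1} := by
    have := isCompact_univ_pi fun _ : Fin n => isCompact_univ_pi fun _ : Fin n =>
      isCompact_closedBall (0 : ℂ) 1
    simp only [Set.pi, Set.mem_univ, true_imp_iff, Set.mem_ofPred_eq] at this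
    exact this
  refine (hS.prod hS).of_isClosed_subset ?_ ?_
  · refine isClosed_eq (Complex.continuous_re.comp (Continuous.matrix_trace ?_)) continuous_const
    exact (continuous_fst.matrix_conjTranspose.mul continuous_fst).add
      (continuous_snd.matrix_conjTranspose.mul continuous_snd)
  · rintro ⟨P, Q⟩ h
    rw [Set.mem_ofPred_eq, trace_add, Complex.add_re, trace_conjTranspose_mul_self_re,
      trace_conjTranspose_mul_self_re] at h
    have key : ∀ P : Matrix (Fin n) (Fin n) ℂ, ∑ j, ∑ i, ‖P i j‖ ^ 2 ≤ 1 →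
        ∀ i j, P i j ∈ Metric.closedBall (0 : ℂ) 1 := fun P hP i j => by
      have h1 : ‖P i j‖ ^ 2 ≤ ∑ i, ‖P i j‖ ^ 2 :=
        Finset.single_le_sum (f := fun i => ‖P i j‖ ^ 2) (fun _ _ => by positivity)
          (Finset.mem_univ i)
      have h2 : ∑ i, ‖P i j‖ ^ 2 ≤ ∑ j, ∑ i, ‖P i j‖ ^ 2 :=
        Finset.single_le_sum (f := fun j => ∑ i, ‖P i j‖ ^ 2) (fun _ _ => by positivity)
          (Finset.mem_univ j)
      rw [mem_closedBall_zero_iff]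
      nlinarith [norm_nonneg (P i j)]
    have hnn : ∀ P : Matrix (Fin n) (Fin n) ℂ, 0 ≤ ∑ j, ∑ i, ‖P i j‖ ^ 2 := fun P => by positivity
    exact ⟨key P (by linarith [hnn Q]), key Q (by linarith [hnn P])⟩

theorem exists_min_of_trace_neg {m k : ℕ} (hm : m ≠ 0) {A₀ B₀ : Matrix (Fin n) (Fin n) ℂ}
    (hA₀ : A₀.PosSemidef) (hB₀ : B₀.PosSemidef) (hneg : (wordCoeff A₀ B₀ m k).trace.re < 0) :
    ∃ A B : Matrix (Fin n) (Fin n) ℂ, A.PosSemidef ∧ B.PosSemidef ∧ (A + B).trace.re = 1 ∧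
      (wordCoeff A B m k).trace.re < 0 ∧
      ∀ A' B' : Matrix (Fin n) (Fin n) ℂ, A'.PosSemidef → B'.PosSemidef →
        (wordCoeff A B m k).trace.re * (A' + B').trace.re ^ m ≤ (wordCoeff A' B' m k).trace.re := by
  set K := {p : Matrix (Fin n) (Fin n) ℂ × Matrix (Fin n) (Fin n) ℂ |
      (p.1ᴴ * p.1 + p.2ᴴ * p.2).trace.re = 1} with hK
  have hscale : ∀ A' B' : Matrix (Fin n) (Fin n) ℂ, A'.PosSemidef → B'.PosSemidef →
      ((A' + B').trace.re = 0 ∧ (wordCoeff A' B' m k).trace.re = 0) ∨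
      (0 < (A' + B').trace.re ∧ ∃ p ∈ K, (wordCoeff A' B' m k).trace.re =
        (A' + B').trace.re ^ m * (wordCoeff (p.1ᴴ * p.1) (p.2ᴴ * p.2) m k).trace.re) := by
    intro A' B' hA' hB'
    set s := (A' + B').trace.re with hs
    have hs0 : 0 ≤ (A' + B').trace := (hA'.add hB').trace_nonneg
    rcases (Complex.le_def.mp hs0).1.eq_or_lt with h | h
    · left
      have h0 : (A' + B').trace = 0 :=
        Complex.ext h.symm (Complex.le_def.mp hs0).2.symm
      have hA0 : A'.trace = 0 := le_antisymm (by
        have := add_le_add_right hB'.trace_nonneg A'.trace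
        rwa [add_zero, ← trace_add, h0] at this) hA'.trace_nonneg
      have hB0 : B'.trace = 0 := by rwa [trace_add, hA0, zero_add] at h0
      rw [hA'.trace_eq_zero_iff] at hA0
      rw [hB'.trace_eq_zero_iff] at hB0
      refine ⟨h.symm, ?_⟩
      have := wordCoeff_smul (0 : Matrix (Fin n) (Fin n) ℂ) 0 0 m k
      rw [smul_zero, zero_pow hm, zero_smul] at this
      rw [hA0, hB0, this]; simp
    · right
      refine ⟨h, ?_⟩
      change 0 < s at h
      have hinv : (0 : ℂ) ≤ ((s⁻¹ : ℝ) : ℂ) := by exact_mod_cast (inv_pos.mpr h).le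
      obtain ⟨P, hP⟩ := exists_conjTranspose_mul_self_of_posSemidef (hA'.smul hinv)
      obtain ⟨Q, hQ⟩ := exists_conjTranspose_mul_self_of_posSemidef (hB'.smul hinv)
      refine ⟨(P, Q), ?_, ?_⟩
      · rw [hK, Set.mem_ofPred_eq]
        dsimp only
        rw [← hP, ← hQ, ← smul_add, trace_smul, smul_eq_mul, Complex.re_ofReal_mul, ← hs,
          inv_mul_cancel₀ h.ne']
      · dsimp only
        rw [← hP, ← hQ, wordCoeff_smul, trace_smul, smul_eq_mul, ← Complex.ofReal_pow,
          Complex.re_ofReal_mul, ← mul_assoc, ← mul_pow, mul_inv_cancel₀ h.ne', one_pow, one_mul]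
  have hpos : ∀ A' B' : Matrix (Fin n) (Fin n) ℂ, A'.PosSemidef → B'.PosSemidef →
    (wordCoeff A' B' m k).trace.re < 0 → ∃ p ∈ K,
      (wordCoeff (p.1ᴴ * p.1) (p.2ᴴ * p.2) m k).trace.re < 0 := by
    intro A' B' hA' hB' h
    obtain ⟨_, h0⟩ | ⟨hs, p, hp, h0⟩ := hscale A' B' hA' hB'
    · linarith
    · exact ⟨p, hp, by rw [h0] at h; exact (pos_iff_neg_of_mul_neg h).mp (pow_pos hs m)⟩
  obtain ⟨p₀, hp₀, hneg₀⟩ := hpos A₀ B₀ hA₀ hB₀ hneg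
  have hcont : Continuous fun p : Matrix (Fin n) (Fin n) ℂ × Matrix (Fin n) (Fin n) ℂ =>
      (wordCoeff (p.1ᴴ * p.1) (p.2ᴴ * p.2) m k).trace.re :=
    Complex.continuous_re.comp (continuous_wordCoeff
      (continuous_fst.matrix_conjTranspose.mul continuous_fst)
      (continuous_snd.matrix_conjTranspose.mul continuous_snd) m k).matrix_trace
  obtain ⟨p, hp, hpmin⟩ := isCompact_trace_eq_one.exists_isMinOn ⟨p₀, hp₀⟩ hcont.continuousOn
  refine ⟨p.1ᴴ * p.1, p.2ᴴ * p.2, posSemidef_conjTranspose_mul_self _,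
    posSemidef_conjTranspose_mul_self _, hp, (hpmin hp₀).trans_lt hneg₀, fun A' B' hA' hB' => ?_⟩
  obtain ⟨h1, h0⟩ | ⟨hs, q, hq, h0⟩ := hscale A' B' hA' hB'
  · rw [h1, h0, zero_pow hm, mul_zero]
  · rw [h0, mul_comm]
    exact mul_le_mul_of_nonneg_left (hpmin hq) (pow_nonneg hs.le m)

/-- If the traces of the sums of words of length `m + 1` with `k + 1` letters `B` are nonnegative,
then so are those of the sums of words with one letter `B` less. -/
theorem trace_wordCoeff_descent {m k : ℕ}
    (h : ∀ A B : Matrix (Fin n) (Fin n) ℂ, A.PosSemidef → B.PosSemidef →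
      0 ≤ (wordCoeff A B (m + 1) (k + 1)).trace.re)
    {A B : Matrix (Fin n) (Fin n) ℂ} (hA : A.PosSemidef) (hB : B.PosSemidef) :
    0 ≤ (wordCoeff A B m k).trace.re := by
  by_contra! hneg
  rcases m with _ | m
  · rcases k with _ | k
    · rw [wordCoeff_zero_zero] at hneg
      simp at hneg
      linarith [n.cast_nonneg (α := ℝ)]
    · rw [wordCoeff_zero_succ] at hneg; simp at hneg
  obtain ⟨A, B, hA, hB, htr, hneg, hmin⟩ := exists_min_of_trace_neg (Nat.succ_ne_zero m) hA hB hneg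
  have h1 := trace_mul_wordCoeff_of_min hA hB hB.isHermitian htr hmin
  have h2 := congrArg Complex.re (trace_wordCoeff_succ_succ A B (m + 1) k)
  have h3 : ∀ (j : ℕ) (z : ℂ), (((j : ℂ) + 1) * z).re = (j + 1) * z.re := fun j z => by simp
  rw [h3, h3] at h2
  have h4 : 0 ≤ (B * wordCoeff A B (m + 1) k).trace.re := by
    have h5 := mul_nonneg (by positivity : (0 : ℝ) ≤ (k : ℝ) + 1) (h A B hA hB)
    rw [h2] at h5
    exact nonneg_of_mul_nonneg_right h5 (by positivity)
  rw [h1, mul_add, trace_add, Complex.add_re] at h4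
  have h5 := trace_mul_re_nonneg hB hA
  have h6 := trace_mul_re_nonneg hB hB
  have h7 : (B * B).trace.re = 0 := by nlinarith
  have h8 : B = 0 := by
    rw [← trace_conjTranspose_mul_self_eq_zero_iff, hB.isHermitian.eq]
    have := hB.pow 2
    rw [pow_two] at this
    exact Complex.ext h7 (Complex.le_def.mp this.trace_nonneg).2.symm
  rw [h8] at hneg
  rcases k with _ | k
  · rw [wordCoeff_zero_eq_pow] at hneg
    exact hneg.not_ge (Complex.le_def.mp (hA.pow (m + 1)).trace_nonneg).1
  · rw [wordCoeff_zero_right_succ] at hneg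
    simp at hneg

end TraceDescent

section BMV

open Polynomial Matrix

variable {n : ℕ}

theorem trace_wordCoeff_nonneg_of_le {a b : ℕ}
    (h : ∀ A B : Matrix (Fin n) (Fin n) ℂ, A.PosSemidef → B.PosSemidef →
      0 ≤ (wordCoeff A B (a + b) b).trace.re) {a' b' : ℕ} (ha : a' ≤ a) (hb : b' ≤ b)
    {A B : Matrix (Fin n) (Fin n) ℂ} (hA : A.PosSemidef) (hB : B.PosSemidef) :
    0 ≤ (wordCoeff A B (a' + b') b').trace.re := by
  have hdesc : ∀ d a b : ℕ, (∀ A B : Matrix (Fin n) (Fin n) ℂ, A.PosSemidef → B.PosSemidef →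
      0 ≤ (wordCoeff A B (a + (b + d)) (b + d)).trace.re) →
      ∀ A B : Matrix (Fin n) (Fin n) ℂ, A.PosSemidef → B.PosSemidef →
        0 ≤ (wordCoeff A B (a + b) b).trace.re := by
    intro d
    induction d with
    | zero => exact fun a b h => h
    | succ d ih => exact fun a b h => ih a b fun A B hA hB => trace_wordCoeff_descent h hA hB
  obtain ⟨d, rfl⟩ := Nat.exists_eq_add_of_le ha
  obtain ⟨e, rfl⟩ := Nat.exists_eq_add_of_le hb
  have h1 := hdesc e (a' + d) b' h
  have h2 := hdesc d b' a' fun A B hA hB => by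
    rw [wordCoeff_swap, add_comm b']
    exact h1 B A hB hA
  rw [wordCoeff_swap, add_comm a']
  exact h2 B A hB hA

theorem trace_wordCoeff_nonneg_of_ge {a b : ℕ} (hab : a + b ≤ 13) (hba : b ≤ a)
    {A B : Matrix (Fin n) (Fin n) ℂ} (hA : A.PosSemidef) (hB : B.PosSemidef) :
    0 ≤ (wordCoeff A B (a + b) b).trace.re := by
  rcases Nat.lt_or_ge b 3 with h2 | h2
  · exact trace_wordCoeff_nonneg_of_le (a := 14) (b := 2) (fun A B hA hB =>
      trace_wordCoeff_nonneg_of_isCertificate one_pos two_pos isCertificate_squaresTwo hA hB)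
      (by omega) (by omega) hA hB
  rcases Nat.lt_or_ge b 5 with h4 | h4
  · exact trace_wordCoeff_nonneg_of_le (a := 10) (b := 4) (fun A B hA hB =>
      trace_wordCoeff_nonneg_of_isCertificate (by decide) (by decide) isCertificate_squaresFour
        hA hB) (by omega) (by omega) hA hB
  · exact trace_wordCoeff_nonneg_of_le (a := 8) (b := 6) (fun A B hA hB =>
      trace_wordCoeff_nonneg_of_isCertificate (by decide) (by decide) isCertificate_squaresSix
        hA hB) (by omega) (by omega) hA hB

theorem trace_wordCoeff_nonneg {m : ℕ} (hm : m ≤ 13) (k : ℕ)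
    {A B : Matrix (Fin n) (Fin n) ℂ} (hA : A.PosSemidef) (hB : B.PosSemidef) :
    0 ≤ (wordCoeff A B m k).trace.re := by
  rcases Nat.lt_or_ge m k with hk | hk
  · rw [wordCoeff_eq_zero A B hk]; simp
  obtain ⟨a, rfl⟩ := Nat.exists_eq_add_of_le' hk
  rcases le_total k a with h | h
  · exact trace_wordCoeff_nonneg_of_ge hm h hA hB
  · rw [wordCoeff_swap, add_comm]
    exact trace_wordCoeff_nonneg_of_ge (by omega) h hB hA

theorem bmvS_eq_wordCoeff (A B : Matrix (Fin n) (Fin n) ℂ) (m k : ℕ) :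
    bmvS m k A B = wordCoeff A B m k := by
  have hcons : ∀ (m : ℕ) (f : (Fin (m + 1) → Bool) → Matrix (Fin n) (Fin n) ℂ),
      ∑ w, f w = ∑ w : Fin m → Bool, (f (Fin.cons false w) + f (Fin.cons true w)) := by
    intro m f
    rw [← (Fin.consEquiv fun _ => Bool).sum_comp, Fintype.sum_prod_type, Fintype.sum_bool,
      ← Finset.sum_add_distrib]
    exact Finset.sum_congr rfl fun w _ => add_comm _ _
  have hword : ∀ (m : ℕ) (b : Bool) (w : Fin m → Bool),
      bmvWord A B (Fin.cons b w : Fin (m + 1) → Bool) =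
      (if b = true then B else A) * bmvWord A B w := by
    intro m b w
    simp [bmvWord, List.ofFn_succ]
  have hcard : ∀ (m : ℕ) (b : Bool) (w : Fin m → Bool),
      (Finset.univ.filter fun i => (Fin.cons b w : Fin (m + 1) → Bool) i = true).card =
        (if b = true then 1 else 0) + (Finset.univ.filter fun i => w i = true).card := by
    intro m b w
    rw [Fin.card_filter_univ_succ]
    cases b <;> simp [add_comm]
  induction m generalizing k with
  | zero =>
    rcases k with _ | k
    · simp [bmvS, bmvWord, wordCoeff_zero_zero]
    · simp [bmvS, wordCoeff_zero_succ]
  | succ m ih =>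
    rw [bmvS, Finset.sum_filter, hcons]
    simp only [hword, hcard]
    rcases k with _ | k
    · rw [wordCoeff_succ_zero, ← ih, bmvS, Finset.sum_filter, Finset.mul_sum]
      refine Finset.sum_congr rfl fun w _ => ?_
      simp
    · rw [wordCoeff_succ_succ, ← ih, ← ih, bmvS, bmvS, Finset.sum_filter, Finset.sum_filter,
        Finset.mul_sum, Finset.mul_sum, ← Finset.sum_add_distrib]
      refine Finset.sum_congr rfl fun w _ => ?_
      simp [add_comm 1]

theorem coeff_bmvPoly (A B : Matrix (Fin n) (Fin n) ℂ) (m k : ℕ) :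
    (bmvPoly m A B).coeff k = (wordCoeff A B m k).trace := by
  have h : ∀ m k, ((A.map C + (X : ℂ[X]) • B.map C) ^ m).map (fun p => p.coeff k) =
      wordCoeff A B m k := by
    intro m
    induction m with
    | zero =>
      rintro (_ | k)
      · rw [wordCoeff_zero_zero]
        ext i j
        by_cases hij : i = j <;> simp [hij, one_apply]
      · rw [wordCoeff_zero_succ]
        ext i j
        by_cases hij : i = j <;> simp [hij, one_apply, coeff_one]
    | succ m ih =>
      rintro (_ | k)
      · rw [wordCoeff_succ_zero, ← ih, pow_succ']
        ext i j
        simp [mul_apply, add_mul]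
      · rw [wordCoeff_succ_succ, ← ih, ← ih, pow_succ']
        ext i j
        simp [mul_apply, add_mul]
  rw [bmvPoly, ← h, trace, trace, finsetSum_coeff]
  rfl

end BMV

theorem theorem1p2 (m : ℕ) (hm : m ≤ 13) (n : ℕ) (A B : Matrix (Fin n) (Fin n) ℂ)
    (hA : A.PosSemidef) (hB : B.PosSemidef) :
    ∃ p : Polynomial ℝ,
      p.map Complex.ofRealHom = bmvPoly m A B ∧
      ∀ k : ℕ, 0 ≤ p.coeff k ∧ (bmvS m k A B).trace = (p.coeff k : ℂ) := by
  have hreal : ∀ k, (wordCoeff A B m k).trace = ((wordCoeff A B m k).trace.re : ℂ) := fun k => by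
    refine (Complex.conj_eq_iff_re.mp ?_).symm
    rw [← Complex.star_def, ← Matrix.trace_conjTranspose,
      (isHermitian_wordCoeff hA.isHermitian hB.isHermitian m k).eq]
  have hcoeff : ∀ k, (∑ i ∈ Finset.range (m + 1),
      Polynomial.monomial i (wordCoeff A B m i).trace.re).coeff k =
        (wordCoeff A B m k).trace.re := fun k => by
    rw [Polynomial.finsetSum_coeff]
    simp only [Polynomial.coeff_monomial, Finset.sum_ite_eq', Finset.mem_range]
    split_ifs with hk
    · rfl
    · rw [wordCoeff_eq_zero A B (by omega)]; simp
  refine ⟨∑ i ∈ Finset.range (m + 1), Polynomial.monomial i (wordCoeff A B m i).trace.re,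
    Polynomial.ext fun k => ?_, fun k => ⟨?_, ?_⟩⟩
  · rw [Polynomial.coeff_map, hcoeff, coeff_bmvPoly, hreal k]; rfl
  · rw [hcoeff]; exact trace_wordCoeff_nonneg hm k hA hB
  · rw [hcoeff, bmvS_eq_wordCoeff]; exact hreal k
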